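/- **Setting.** Let $d>0$, let $V:\mathbb R\to\mathbb R$ be locally integrable with $V(x+d)=V(x)$ for all $x$, let $\Gamma_\pm,\mu_s\in\mathbb R$ and $\Gamma(x)=\Gamma_+\chi_{[0,\infty)}(x)+\Gamma_-\chi_{(-\infty,0)}(x)$. Let $\phi_s:\mathbb R\to\mathbb R$ be a $C^1$ solution of $\phi_s''+\mu_s\phi_s-V\phi_s+\Gamma\phi_s^3=0$ with $|\phi_s(x)|\le Ce^{-\alpha|x|}$ for some $C\in\mathbb R$, $\alpha>0$. (All differential equations are understood in the Carathéodory sense: the function, and for second-order equations also its derivative, is locally absolutely continuous and the equation holds almost everywhere.) For $\lambda\in\mathbb C$ put $\mu_\pm=\mu_s\pm i\lambda$ and consider the first-order spectral system for $v=(u_1,u_1',u_2,u_2')$, $$v'=A(x;\lambda)v,\qquad A=\begin{pmatrix}0&1&0&0\\ V-2\Gamma\phi_s^2-\mu_+&0&-\Gamma\phi_s^2&0\\0&0&0&1\\-\Gamma\phi_s^2&0&V-2\Gamma\phi_s^2-\mu_-&0\end{pmatrix}.$$ Let $\psi_{1,2}^{\mu_+}(x)=p_{1,2}^{\mu_+}(x)e^{\pm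 ik_+x}$ and $\psi_{1,2}^{\mu_-}(x)=p_{1,2}^{\mu_-}(x)e^{\pm ik_-x}$, with $\operatorname{Im}k_\pm>0$, $d$-periodic $p_{1,2}^{\mu_\pm}$ and $p_{1,2}^{\mu_\pm}(0)=1$, be Bloch waves of Hill's equations $-\psi''+V\psi=\mu_+\psi$ and $-\psi''+V\psi=\mu_-\psi$ respectively. Let $v_1^\pm,v_2^\pm$ be solutions of $v'=Av$ on $\mathbb R$ with $$v_1^-\sim(\psi_2^{\mu_+},(\psi_2^{\mu_+})',0,0)^T,\quad v_2^-\sim(0,0,\psi_2^{\mu_-},(\psi_2^{\mu_-})')^T\quad (x\to-\infty),$$ $$v_1^+\sim(\psi_1^{\mu_+},(\psi_1^{\mu_+})',0,0)^T,\quad v_2^+\sim(0,0,\psi_1^{\mu_-},(\psi_1^{\mu_-})')^T\quad (x\to+\infty),$$ where $v\sim w$ means $\|v-w\|=o(\|w\|)$. For those $\lambda$ for which such Bloch waves and solutions exist (the domain of definition), the Evans function is $$\mathcal E(\lambda)=\det\big(v_1^-(x_*;\lambda),v_2^-(x_*;\lambda),v_1^+(x_*;\lambda),v_2^+(x_*;\lambda)\big),\qquad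 x_*\in\mathbb R.$$ **Lemma.** The value $\mathcal E(\lambda)$ depends neither on $x_*$ nor on the choice of $k_\pm$, the Bloch waves and the solutions $v_{1,2}^\pm$; the domain of definition is invariant under complex conjugation; and $\mathcal E(\bar\lambda)=\overline{\mathcal E(\lambda)}$ for every $\lambda$ in it. -/

import Mathlib

open Filter Asymptotics MeasureTheory

noncomputable section

/-- The nonlinear coefficient `Γ₊ χ_{[0,∞)} + Γ₋ χ_{(-∞,0)}`. -/
def interfaceCoeff (Γp Γm : ℝ) (x : ℝ) : ℝ := if 0 ≤ x then Γp else Γm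

/-- Real, exponentially localized `C¹` solutions of `φ'' + μ φ - V φ + Γ φ³ = 0`. As `Γ` (and possibly
`V`) is discontinuous, the equation is read in the Carathéodory sense: `φ'` is locally absolutely
continuous and the equation holds almost everywhere, that is, it holds after one integration. -/
structure IsGapSoliton (V : ℝ → ℝ) (Γp Γm μs : ℝ) (φ : ℝ → ℝ) : Prop where
  contDiff : ContDiff ℝ 1 φ
  eqn : ∀ x, deriv φ x = deriv φ 0 +
    ∫ t in (0 : ℝ)..x, (V t * φ t - μs * φ t - interfaceCoeff Γp Γm t * φ t ^ 3)
  localized : ∃ C α : ℝ, 0 < α ∧ ∀ x, |φ x| ≤ C * Real.exp (-α * |x|)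

/-- `C¹` solutions of Hill's equation `-ψ'' + V ψ = μ ψ`, in the Carathéodory sense. -/
structure IsHillSolution (V : ℝ → ℝ) (μ : ℂ) (ψ : ℝ → ℂ) : Prop where
  contDiff : ContDiff ℝ 1 ψ
  eqn : ∀ x, deriv ψ x = deriv ψ 0 + ∫ t in (0 : ℝ)..x, ((V t : ℂ) - μ) * ψ t

/-- `ψ` is the Bloch wave `ψ(x) = p(x) e^{ikx}` of Hill's equation, `p` being `d`-periodic and
normalized by `p(0) = 1`. -/
structure IsBlochWave (V : ℝ → ℝ) (d : ℝ) (μ k : ℂ) (ψ : ℝ → ℂ) : Prop where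
  hill : IsHillSolution V μ ψ
  bloch : ∃ p : ℝ → ℂ, Function.Periodic p d ∧ p 0 = 1 ∧
    ∀ x, ψ x = p x * Complex.exp (Complex.I * k * x)

/-- The coefficient matrix of the first-order spectral system for `(u₁, u₁', u₂, u₂')`,
with `μ_± = μ_s ± iλ`. -/
def spectralMatrix (V : ℝ → ℝ) (Γp Γm μs : ℝ) (φ : ℝ → ℝ) (lam : ℂ) (x : ℝ) :
    Matrix (Fin 4) (Fin 4) ℂ :=
  let g : ℂ := ((interfaceCoeff Γp Γm x * φ x ^ 2 : ℝ) : ℂ)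
  !![0, 1, 0, 0;
     (V x : ℂ) - 2 * g - (μs + Complex.I * lam), 0, -g, 0;
     0, 0, 0, 1;
     -g, 0, (V x : ℂ) - 2 * g - (μs - Complex.I * lam), 0]

/-- Carathéodory solutions on `ℝ` of the linear system `v' = A v`. -/
structure IsSystemSolution (A : ℝ → Matrix (Fin 4) (Fin 4) ℂ) (v : ℝ → Fin 4 → ℂ) : Prop where
  continuous : Continuous v
  eqn : ∀ x, v x = v 0 + ∫ t in (0 : ℝ)..x, (A t).mulVec (v t)

/-- The solutions `v₁⁻, v₂⁻, v₁⁺, v₂⁺` of the spectral system at `λ` that enter the Evans function,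
with the normalized Bloch waves `ψ_{1,2}^{μ_+}` and `ψ_{1,2}^{μ_-}` to which they are asymptotic.
The relation `v ~[l] w` means `‖v - w‖ = o(‖w‖)` along `l`. -/
structure EvansFrame (V : ℝ → ℝ) (d Γp Γm μs : ℝ) (φ : ℝ → ℝ) (lam : ℂ) where
  (kp km : ℂ)
  (ψp₁ ψp₂ ψm₁ ψm₂ : ℝ → ℂ)
  (vm₁ vm₂ vp₁ vp₂ : ℝ → Fin 4 → ℂ)
  kp_im_pos : 0 < kp.im
  km_im_pos : 0 < km.im
  bloch_p₁ : IsBlochWave V d (μs + Complex.I * lam) kp ψp₁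
  bloch_p₂ : IsBlochWave V d (μs + Complex.I * lam) (-kp) ψp₂
  bloch_m₁ : IsBlochWave V d (μs - Complex.I * lam) km ψm₁
  bloch_m₂ : IsBlochWave V d (μs - Complex.I * lam) (-km) ψm₂
  sol_vm₁ : IsSystemSolution (spectralMatrix V Γp Γm μs φ lam) vm₁
  sol_vm₂ : IsSystemSolution (spectralMatrix V Γp Γm μs φ lam) vm₂
  sol_vp₁ : IsSystemSolution (spectralMatrix V Γp Γm μs φ lam) vp₁
  sol_vp₂ : IsSystemSolution (spectralMatrix V Γp Γm μs φ lam) vp₂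
  asymp_vm₁ : vm₁ ~[atBot] fun x => ![ψp₂ x, deriv ψp₂ x, 0, 0]
  asymp_vm₂ : vm₂ ~[atBot] fun x => ![0, 0, ψm₂ x, deriv ψm₂ x]
  asymp_vp₁ : vp₁ ~[atTop] fun x => ![ψp₁ x, deriv ψp₁ x, 0, 0]
  asymp_vp₂ : vp₂ ~[atTop] fun x => ![0, 0, ψm₁ x, deriv ψm₁ x]

/-- The determinant with columns `v₁⁻(x), v₂⁻(x), v₁⁺(x), v₂⁺(x)`. -/
def EvansFrame.det {V : ℝ → ℝ} {d Γp Γm μs : ℝ} {φ : ℝ → ℝ} {lam : ℂ}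
    (F : EvansFrame V d Γp Γm μs φ lam) (x : ℝ) : ℂ :=
  Matrix.det (Matrix.of ![F.vm₁ x, F.vm₂ x, F.vp₁ x, F.vp₂ x]).transpose

open scoped Classical in
/-- The Evans function, evaluated at the matching point `xs`. Outside its domain of definition,
where the normalized exponentially decaying Bloch waves do not exist, it is given the value `0`. -/
def evansFunction (V : ℝ → ℝ) (d Γp Γm μs : ℝ) (φ : ℝ → ℝ) (xs : ℝ) (lam : ℂ) : ℂ :=
  if h : Nonempty (EvansFrame V d Γp Γm μs φ lam) then h.some.det xs else 0

end

/-!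
The spectral system is Hamiltonian: the sum of the Wronskians of the two components is a symplectic
form which is constant along pairs of solutions, and the determinant of four solutions is the
Pfaffian of the matrix of their mutual forms. Hence the determinant does not depend on `x`.

Solutions which decay at the same end are mutually orthogonal for this form, so they span an
isotropic, hence at most two-dimensional, space. Two admissible pairs of solutions at one end are
therefore related by a constant `2 × 2` matrix. Its determinant is `1`, as one sees by comparing the
minors of `u₁, u₂` along the lattice `dℤ`, on which the Bloch waves have no zeros. So the Evans
determinant does not depend on the choices either.

Complex conjugation and the exchange of `u₁` and `u₂` carry the system at `λ` to the system at the
conjugate of `λ`. The exchange permutes two pairs of rows and two pairs of columns of the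
determinant, which leaves it unchanged.
-/

open Set
open scoped Topology Matrix

section Primitives

variable {E : Type*} [NormedAddCommGroup E]

theorem intervalIntegrable_of_locallyIntegrable {f : ℝ → E} (hf : LocallyIntegrable f volume)
    (a b : ℝ) : IntervalIntegrable f volume a b :=
  (hf.integrableOn_isCompact isCompact_uIcc).intervalIntegrable

theorem locallyIntegrable_ofReal {f : ℝ → ℝ} (hf : LocallyIntegrable f volume) :
    LocallyIntegrable (fun x => (f x : ℂ)) volume :=
  hf.mono (Complex.continuous_ofReal.comp_aestronglyMeasurable hf.aestronglyMeasurable) (by simp)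

theorem absolutelyContinuousOnInterval_of_norm_sub_le_integral {v : ℝ → E} {m : ℝ → ℝ}
    (hm : LocallyIntegrable m volume) (hv : ∀ x y, ‖v y - v x‖ ≤ |∫ t in x..y, m t|) (a b : ℝ) :
    AbsolutelyContinuousOnInterval v a b := by
  have hint := intervalIntegrable_of_locallyIntegrable hm
  have hac : AbsolutelyContinuousOnInterval (fun x => ∫ t in a..x, m t) a b :=
    (hint a b).absolutelyContinuousOnInterval_intervalIntegral left_mem_uIcc
  refine squeeze_zero (fun _ => Finset.sum_nonneg fun _ _ => dist_nonneg)
    (fun _ => Finset.sum_le_sum fun _ _ => ?_) hac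
  rw [dist_eq_norm, Real.dist_eq,
    intervalIntegral.integral_interval_sub_left (hint _ _) (hint _ _)]
  exact hv _ _

-- Grönwall on a short interval: where `|∫ m| < 1 / 2`, the maximum `M` of `‖v‖` is at most `M / 2`.
theorem eventually_eq_zero_of_norm_sub_le_integral {v : ℝ → E} {m : ℝ → ℝ} (hv : Continuous v)
    (hm : LocallyIntegrable m volume) (hm₀ : ∀ t, 0 ≤ m t)
    (hle : ∀ x y, ‖v y - v x‖ ≤ |∫ t in x..y, m t * ‖v t‖|) {x : ℝ} (hx : v x = 0) :
    ∀ᶠ y in 𝓝 x, v y = 0 := by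
  have hint := intervalIntegrable_of_locallyIntegrable hm
  have hsmall : ∀ᶠ y in 𝓝 x, |∫ t in x..y, m t| < 1 / 2 := by
    have hcont := (intervalIntegral.continuous_primitive hint x).abs.tendsto x
    rw [intervalIntegral.integral_same, abs_zero] at hcont
    exact hcont.eventually_lt_const (by norm_num)
  obtain ⟨δ, hδ, hsmall⟩ := Metric.nhds_basis_closedBall.eventually_iff.1 hsmall
  have hxδ : x ∈ Metric.closedBall x δ := Metric.mem_closedBall_self hδ.le
  obtain ⟨z, hz, hmax⟩ :=
    (isCompact_closedBall x δ).exists_isMaxOn ⟨x, hxδ⟩ hv.norm.continuousOn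
  have hvz : ‖v z‖ ≤ |∫ t in x..z, m t| * ‖v z‖ :=
    calc ‖v z‖ = ‖v z - v x‖ := by rw [hx, sub_zero]
      _ ≤ |∫ t in x..z, m t * ‖v t‖| := hle x z
      _ ≤ |∫ t in x..z, m t * ‖v z‖| := by
        rw [← Real.norm_eq_abs]
        refine intervalIntegral.norm_integral_le_abs_of_norm_le
          ((ae_restrict_iff' measurableSet_uIoc).2 (Eventually.of_forall fun t ht => ?_))
          ((hint x z).mul_const _)
        rw [Real.norm_of_nonneg (mul_nonneg (hm₀ t) (norm_nonneg _))]
        refine mul_le_mul_of_nonneg_left (hmax ?_) (hm₀ t)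
        exact (convex_closedBall x δ).ordConnected.uIcc_subset hxδ hz (uIoc_subset_uIcc ht)
      _ = |∫ t in x..z, m t| * ‖v z‖ := by
        rw [intervalIntegral.integral_mul_const, abs_mul, abs_norm]
  have hz₀ : ‖v z‖ = 0 := by nlinarith [norm_nonneg (v z), hsmall hz]
  filter_upwards [Metric.closedBall_mem_nhds x hδ] with y hy
  exact norm_le_zero_iff.1 (hz₀ ▸ hmax hy)

theorem eq_zero_of_norm_sub_le_integral {v : ℝ → E} {m : ℝ → ℝ} (hv : Continuous v)
    (hm : LocallyIntegrable m volume) (hm₀ : ∀ t, 0 ≤ m t)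
    (hle : ∀ x y, ‖v y - v x‖ ≤ |∫ t in x..y, m t * ‖v t‖|) {x₀ : ℝ} (hx₀ : v x₀ = 0) :
    v = 0 := by
  have hopen : IsOpen {x | v x = 0} := isOpen_iff_mem_nhds.2 fun _ hx =>
    eventually_eq_zero_of_norm_sub_le_integral hv hm hm₀ hle hx
  have hclosed : IsClosed {x | v x = 0} := isClosed_eq hv continuous_const
  exact funext <| eq_univ_iff_forall.1 <| IsClopen.eq_univ ⟨hclosed, hopen⟩ ⟨x₀, hx₀⟩

end Primitives

section Wronskian

/-- The standard symplectic form on `ℂ⁴` with coordinates `(u₁, u₁', u₂, u₂')`, that is, the sum of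
the Wronskians of the two components. -/
def wronskian (v w : Fin 4 → ℂ) : ℂ := v 0 * w 1 - v 1 * w 0 + v 2 * w 3 - v 3 * w 2

theorem wronskian_zero_left (w : Fin 4 → ℂ) : wronskian 0 w = 0 := by
  simp [wronskian]

theorem tendsto_wronskian {ι : Type*} {l : Filter ι} {v w : ι → Fin 4 → ℂ} {a b : Fin 4 → ℂ}
    (hv : Tendsto v l (𝓝 a)) (hw : Tendsto w l (𝓝 b)) :
    Tendsto (fun i => wronskian (v i) (w i)) l (𝓝 (wronskian a b)) := by
  rw [tendsto_pi_nhds] at hv hw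
  exact ((((hv 0).mul (hw 1)).sub ((hv 1).mul (hw 0))).add ((hv 2).mul (hw 3))).sub
    ((hv 3).mul (hw 2))

theorem det_eq_wronskian (v₁ v₂ v₃ v₄ : Fin 4 → ℂ) :
    (Matrix.of ![v₁, v₂, v₃, v₄])ᵀ.det =
      wronskian v₁ v₂ * wronskian v₃ v₄ - wronskian v₁ v₃ * wronskian v₂ v₄
        + wronskian v₁ v₄ * wronskian v₂ v₃ := by
  rw [Matrix.det_transpose, Matrix.det_succ_row_zero, Fin.sum_univ_four]
  simp only [wronskian, Matrix.det_fin_three, Matrix.submatrix_apply, Matrix.of_apply,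
    Matrix.cons_val, Fin.succAbove, Fin.reduceSucc, Fin.reduceCastSucc, Fin.reduceLT, ↓reduceIte,
    Fin.coe_ofNat_eq_mod]
  ring

theorem det_combination_pairs (a b c e a' b' c' e' : ℂ) (v₁ v₂ v₃ v₄ : Fin 4 → ℂ) :
    (Matrix.of ![a • v₁ + b • v₂, c • v₁ + e • v₂, a' • v₃ + b' • v₄, c' • v₃ + e' • v₄])ᵀ.det =
      (a * e - b * c) * (a' * e' - b' * c') * (Matrix.of ![v₁, v₂, v₃, v₄])ᵀ.det := by
  simp only [det_eq_wronskian, wronskian, Pi.add_apply, Pi.smul_apply, smul_eq_mul]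
  ring

-- An isotropic subspace of `ℂ⁴` has dimension at most two: by `det_eq_wronskian`, three pairwise
-- orthogonal vectors have zero determinant with every fourth one.
theorem mem_span_pair_of_wronskian_eq_zero {z v w : Fin 4 → ℂ} (hzv : wronskian z v = 0)
    (hzw : wronskian z w = 0) (hvw : wronskian v w = 0) (hli : LinearIndependent ℂ ![v, w]) :
    z ∈ Submodule.span ℂ {v, w} := by
  by_contra hz
  have hzvw : LinearIndependent ℂ ![z, v, w] :=
    linearIndependent_finCons.2 ⟨hli, by simpa [Matrix.range_cons, pair_comm] using hz⟩
  obtain ⟨u, hu⟩ := exists_linearIndependent_cons_of_lt_finrank hzvw (by simp)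
  have hdet : (Matrix.of ![u, z, v, w])ᵀ.det = 0 := by
    rw [det_eq_wronskian, hzv, hzw, hvw]
    ring
  rw [Matrix.det_transpose] at hdet
  exact ((Matrix.isUnit_iff_isUnit_det (Matrix.of ![u, z, v, w])).1
    (Matrix.linearIndependent_rows_iff_isUnit.1 hu)).ne_zero hdet

/-- The minor of the components `u₁, u₂` of two vectors `(u₁, u₁', u₂, u₂')`. Its asymptotics fix
the normalization of a pair of decaying solutions. -/
def positionMinor (v w : Fin 4 → ℂ) : ℂ := v 0 * w 2 - v 2 * w 0

theorem positionMinor_combination (a b c e : ℂ) (v w : Fin 4 → ℂ) :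
    positionMinor (a • v + b • w) (c • v + e • w) = (a * e - b * c) * positionMinor v w := by
  simp only [positionMinor, Pi.add_apply, Pi.smul_apply, smul_eq_mul]
  ring

theorem linearIndependent_pair_of_positionMinor_ne_zero {v w : Fin 4 → ℂ}
    (h : positionMinor v w ≠ 0) : LinearIndependent ℂ ![v, w] := by
  rw [LinearIndependent.pair_iff]
  intro a b hab
  have h₀ : a * v 0 + b * w 0 = 0 := congrFun hab 0
  have h₂ : a * v 2 + b * w 2 = 0 := congrFun hab 2
  have ha : a * positionMinor v w = 0 := by
    rw [positionMinor]
    linear_combination w 2 * h₀ - w 0 * h₂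
  have hb : b * positionMinor v w = 0 := by
    rw [positionMinor]
    linear_combination v 0 * h₂ - v 2 * h₀
  exact ⟨(mul_eq_zero.1 ha).resolve_right h, (mul_eq_zero.1 hb).resolve_right h⟩

end Wronskian

section System

theorem locallyIntegrable_mulVec {m n : Type*} [Fintype m] [Fintype n] {A : ℝ → Matrix m n ℂ}
    (hA : ∀ i j, LocallyIntegrable (fun x => A x i j) volume) {v : ℝ → n → ℂ} (hv : Continuous v) :
    LocallyIntegrable (fun x => A x *ᵥ v x) volume := by
  refine locallyIntegrable_iff.2 fun K hK => Integrable.of_eval fun i => ?_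
  simp only [Matrix.mulVec, dotProduct]
  exact integrable_finsetSum _ fun j _ =>
    ((hA i j).integrableOn_isCompact hK).mul_continuousOn
      ((continuous_apply j).comp hv).continuousOn hK

theorem locallyIntegrable_sum_norm {m n : Type*} [Fintype m] [Fintype n] {A : ℝ → Matrix m n ℂ}
    (hA : ∀ i j, LocallyIntegrable (fun x => A x i j) volume) :
    LocallyIntegrable (fun x => ∑ i, ∑ j, ‖A x i j‖) volume :=
  locallyIntegrable_iff.2 fun _ hK => integrable_finsetSum _ fun i _ =>
    integrable_finsetSum _ fun j _ => ((hA i j).integrableOn_isCompact hK).norm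

theorem norm_mulVec_le_sum_norm_mul {m n : Type*} [Fintype m] [Fintype n] (M : Matrix m n ℂ)
    (v : n → ℂ) :
    ‖M *ᵥ v‖ ≤ (∑ i, ∑ j, ‖M i j‖) * ‖v‖ := by
  refine (pi_norm_le_iff_of_nonneg (by positivity)).2 fun i => ?_
  calc ‖∑ j, M i j * v j‖ ≤ ∑ j, ‖M i j‖ * ‖v‖ := norm_sum_le_of_le _ fun j _ =>
        (norm_mul _ _).trans_le (mul_le_mul_of_nonneg_left (norm_le_pi_norm v j) (norm_nonneg _))
    _ = (∑ j, ‖M i j‖) * ‖v‖ := (Finset.sum_mul ..).symm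
    _ ≤ (∑ i, ∑ j, ‖M i j‖) * ‖v‖ :=
      mul_le_mul_of_nonneg_right (Finset.single_le_sum (f := fun i => ∑ j, ‖M i j‖)
        (fun i _ => by positivity) (Finset.mem_univ i)) (norm_nonneg v)

/-- A linear system `v' = A v` on `ℂ⁴` with locally integrable coefficients whose matrices are
infinitesimally symplectic, so that `wronskian` is constant along pairs of solutions. -/
structure IsHamiltonianSystem (A : ℝ → Matrix (Fin 4) (Fin 4) ℂ) : Prop where
  locallyIntegrable : ∀ i j, LocallyIntegrable (fun x => A x i j) volume
  wronskian_mulVec : ∀ x v w, wronskian (A x *ᵥ v) w + wronskian v (A x *ᵥ w) = 0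

namespace IsSystemSolution

variable {A : ℝ → Matrix (Fin 4) (Fin 4) ℂ} {v w z : ℝ → Fin 4 → ℂ}

theorem sub_eq_integral (hA : ∀ i j, LocallyIntegrable (fun x => A x i j) volume)
    (hv : IsSystemSolution A v) (x y : ℝ) : v y - v x = ∫ t in x..y, A t *ᵥ v t := by
  have hint := intervalIntegrable_of_locallyIntegrable (locallyIntegrable_mulVec hA hv.continuous)
  rw [hv.eqn y, hv.eqn x, add_sub_add_left_eq_sub,
    intervalIntegral.integral_interval_sub_left (hint _ _) (hint _ _)]

theorem absolutelyContinuousOnInterval (hA : ∀ i j, LocallyIntegrable (fun x => A x i j) volume)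
    (hv : IsSystemSolution A v) (i : Fin 4) (a b : ℝ) :
    AbsolutelyContinuousOnInterval (fun x => v x i) a b := by
  have hloc := locallyIntegrable_mulVec hA hv.continuous
  refine absolutelyContinuousOnInterval_of_norm_sub_le_integral
    (m := fun x => ‖A x *ᵥ v x‖) (hloc.mono hloc.aestronglyMeasurable.norm (by simp)) ?_ a b
  intro x y
  calc ‖v y i - v x i‖ ≤ ‖v y - v x‖ := norm_le_pi_norm (v y - v x) i
    _ = ‖∫ t in x..y, A t *ᵥ v t‖ := by rw [hv.sub_eq_integral hA]
    _ ≤ |∫ t in x..y, ‖A t *ᵥ v t‖| := intervalIntegral.norm_integral_le_abs_integral_norm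

theorem ae_hasDerivAt (hA : ∀ i j, LocallyIntegrable (fun x => A x i j) volume)
    (hv : IsSystemSolution A v) : ∀ᵐ x, HasDerivAt v (A x *ᵥ v x) x := by
  filter_upwards [LocallyIntegrable.ae_hasDerivAt_integral
    (locallyIntegrable_mulVec hA hv.continuous)] with x hx
  exact ((hx 0).const_add (v 0)).congr_of_eventuallyEq (Eventually.of_forall hv.eqn)

theorem add (hA : ∀ i j, LocallyIntegrable (fun x => A x i j) volume)
    (hv : IsSystemSolution A v) (hw : IsSystemSolution A w) : IsSystemSolution A (v + w) := by
  have hint {u : ℝ → Fin 4 → ℂ} (hu : Continuous u) :=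
    intervalIntegrable_of_locallyIntegrable (locallyIntegrable_mulVec hA hu)
  refine ⟨hv.continuous.add hw.continuous, fun x => ?_⟩
  simp only [Pi.add_apply, Matrix.mulVec_add]
  rw [intervalIntegral.integral_add (hint hv.continuous _ _) (hint hw.continuous _ _),
    hv.eqn x, hw.eqn x, add_add_add_comm]

theorem const_smul (c : ℂ) (hv : IsSystemSolution A v) : IsSystemSolution A (c • v) := by
  refine ⟨hv.continuous.const_smul c, fun x => ?_⟩
  simp only [Pi.smul_apply, Matrix.mulVec_smul]
  rw [intervalIntegral.integral_smul, ← smul_add, ← hv.eqn x]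

theorem eq_zero (hA : ∀ i j, LocallyIntegrable (fun x => A x i j) volume)
    (hv : IsSystemSolution A v) {x₀ : ℝ} (hx₀ : v x₀ = 0) : v = 0 := by
  have hm := locallyIntegrable_sum_norm hA
  refine eq_zero_of_norm_sub_le_integral hv.continuous hm (fun t => by positivity) ?_ hx₀
  intro x y
  have hmv : LocallyIntegrable (fun t => (∑ i, ∑ j, ‖A t i j‖) * ‖v t‖) volume :=
    hm.mul_continuous hv.continuous.norm
  rw [hv.sub_eq_integral hA]
  exact intervalIntegral.norm_integral_le_abs_of_norm_le
    (Eventually.of_forall fun t => norm_mulVec_le_sum_norm_mul (A t) (v t))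
    (intervalIntegrable_of_locallyIntegrable hmv x y)

theorem eq_of_apply_eq (hA : ∀ i j, LocallyIntegrable (fun x => A x i j) volume)
    (hv : IsSystemSolution A v) (hw : IsSystemSolution A w) {x₀ : ℝ} (hx₀ : v x₀ = w x₀) :
    v = w := by
  have hzero := (hv.add hA (hw.const_smul (-1))).eq_zero hA (x₀ := x₀) (by simp [hx₀])
  rwa [neg_one_smul, ← sub_eq_add_neg, sub_eq_zero] at hzero

theorem wronskian_eq (hA : IsHamiltonianSystem A) (hv : IsSystemSolution A v)
    (hw : IsSystemSolution A w) (x y : ℝ) : wronskian (v x) (w x) = wronskian (v y) (w y) := by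
  have hac : AbsolutelyContinuousOnInterval (fun t => wronskian (v t) (w t)) x y := by
    have hv' i := hv.absolutelyContinuousOnInterval hA.locallyIntegrable i x y
    have hw' i := hw.absolutelyContinuousOnInterval hA.locallyIntegrable i x y
    exact ((((hv' 0).fun_smul (hw' 1)).fun_sub ((hv' 1).fun_smul (hw' 0))).fun_add
      ((hv' 2).fun_smul (hw' 3))).fun_sub ((hv' 3).fun_smul (hw' 2))
  have hderiv : ∀ᵐ t, HasDerivAt (fun t => wronskian (v t) (w t)) 0 t := by
    filter_upwards [hv.ae_hasDerivAt hA.locallyIntegrable,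
      hw.ae_hasDerivAt hA.locallyIntegrable] with t hvt hwt
    rw [hasDerivAt_pi] at hvt hwt
    refine (((((hvt 0).mul (hwt 1)).sub ((hvt 1).mul (hwt 0))).add
      ((hvt 2).mul (hwt 3))).sub ((hvt 3).mul (hwt 2))).congr_deriv ?_
    rw [← hA.wronskian_mulVec t (v t) (w t), wronskian, wronskian]
    ring
  obtain ⟨C, hC⟩ := hac.const_of_ae_hasDerivAt_zero (hderiv.mono fun _ h _ => h)
  rw [hC x left_mem_uIcc, hC y right_mem_uIcc]

theorem wronskian_eq_zero (hA : IsHamiltonianSystem A) {l : Filter ℝ} [l.NeBot]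
    (hv : IsSystemSolution A v) (hw : IsSystemSolution A w) (hvl : Tendsto v l (𝓝 0))
    (hwl : Tendsto w l (𝓝 0)) (x : ℝ) : wronskian (v x) (w x) = 0 := by
  have hlim := tendsto_wronskian hvl hwl
  simp only [fun y => hv.wronskian_eq hA hw y x, wronskian_zero_left] at hlim
  exact tendsto_nhds_unique tendsto_const_nhds hlim

theorem exists_eq_combination (hA : IsHamiltonianSystem A) {l : Filter ℝ} [l.NeBot]
    (hz : IsSystemSolution A z) (hv : IsSystemSolution A v) (hw : IsSystemSolution A w)
    (hzl : Tendsto z l (𝓝 0)) (hvl : Tendsto v l (𝓝 0)) (hwl : Tendsto w l (𝓝 0)) {x : ℝ}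
    (hli : LinearIndependent ℂ ![v x, w x]) : ∃ a b : ℂ, z = a • v + b • w := by
  have hspan : z x ∈ Submodule.span ℂ {v x, w x} :=
    mem_span_pair_of_wronskian_eq_zero (hz.wronskian_eq_zero hA hv hzl hvl x)
      (hz.wronskian_eq_zero hA hw hzl hwl x) (hv.wronskian_eq_zero hA hw hvl hwl x) hli
  obtain ⟨a, b, hab⟩ := Submodule.mem_span_pair.1 hspan
  have hsol : IsSystemSolution A (a • v + b • w) :=
    (hv.const_smul a).add hA.locallyIntegrable (hw.const_smul b)
  exact ⟨a, b, hz.eq_of_apply_eq hA.locallyIntegrable hsol (x₀ := x) hab.symm⟩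

end IsSystemSolution

end System

section SpectralMatrix

variable {V : ℝ → ℝ} {φ : ℝ → ℝ}

theorem locallyIntegrable_interfaceCoeff (Γp Γm : ℝ) :
    LocallyIntegrable (interfaceCoeff Γp Γm) volume := by
  have hmeas : Measurable (interfaceCoeff Γp Γm) :=
    Measurable.ite measurableSet_Ici measurable_const measurable_const
  refine (locallyIntegrable_const (max |Γp| |Γm|)).mono hmeas.aestronglyMeasurable
    (Eventually.of_forall fun x => le_trans ?_ (le_abs_self _))
  rw [interfaceCoeff, Real.norm_eq_abs]
  split_ifs
  exacts [le_max_left _ _, le_max_right _ _]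

theorem locallyIntegrable_spectralMatrix (hV : LocallyIntegrable V volume) (hφ : Continuous φ)
    (Γp Γm μs : ℝ) (lam : ℂ) (i j : Fin 4) :
    LocallyIntegrable (fun x => spectralMatrix V Γp Γm μs φ lam x i j) volume := by
  have hg : LocallyIntegrable
      (fun x => ((interfaceCoeff Γp Γm x * φ x ^ 2 : ℝ) : ℂ)) volume :=
    locallyIntegrable_ofReal <|
      (locallyIntegrable_interfaceCoeff Γp Γm).mul_continuous (hφ.pow 2)
  have hconst (c : ℂ) : LocallyIntegrable (fun _ : ℝ => c) volume := locallyIntegrable_const c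
  have hdiag (c : ℂ) : LocallyIntegrable
      (fun x => (V x : ℂ) - 2 * ((interfaceCoeff Γp Γm x * φ x ^ 2 : ℝ) : ℂ) - c) volume :=
    ((locallyIntegrable_ofReal hV).sub (hg.smul (2 : ℂ))).sub (hconst c)
  fin_cases i <;> fin_cases j
  all_goals first | exact hconst 0 | exact hconst 1 | exact hg.neg | exact hdiag _

theorem spectralMatrix_mulVec (V : ℝ → ℝ) (Γp Γm μs : ℝ) (φ : ℝ → ℝ) (lam : ℂ) (x : ℝ)
    (v : Fin 4 → ℂ) :
    spectralMatrix V Γp Γm μs φ lam x *ᵥ v =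
      let g : ℂ := ((interfaceCoeff Γp Γm x * φ x ^ 2 : ℝ) : ℂ)
      ![v 1, ((V x : ℂ) - 2 * g - (μs + Complex.I * lam)) * v 0 - g * v 2,
        v 3, ((V x : ℂ) - 2 * g - (μs - Complex.I * lam)) * v 2 - g * v 0] := by
  ext i
  fin_cases i <;>
    simp [spectralMatrix, Matrix.mulVec, dotProduct, Fin.sum_univ_four, sub_eq_add_neg, add_comm]

theorem isHamiltonianSystem_spectralMatrix (hV : LocallyIntegrable V volume) (hφ : Continuous φ)
    (Γp Γm μs : ℝ) (lam : ℂ) : IsHamiltonianSystem (spectralMatrix V Γp Γm μs φ lam) where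
  locallyIntegrable := locallyIntegrable_spectralMatrix hV hφ Γp Γm μs lam
  wronskian_mulVec x v w := by
    simp only [spectralMatrix_mulVec, wronskian, Matrix.cons_val]
    ring

end SpectralMatrix

section BlochWaves

variable {V : ℝ → ℝ} {d : ℝ} {μ k : ℂ} {ψ ψ' : ℝ → ℂ} {l : Filter ℝ}

theorem spectralMatrix_zero_mulVec (V : ℝ → ℝ) (μ : ℂ) (x : ℝ) (a b : ℂ) :
    spectralMatrix V 0 0 0 0 (-Complex.I * μ) x *ᵥ ![a, b, 0, 0] =
      ![b, ((V x : ℂ) - μ) * a, 0, 0] := by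
  ext i
  fin_cases i <;> simp [spectralMatrix_mulVec, ← mul_assoc]

-- Hill's equation is the first block of the spectral system with `φ = 0` and `μ_s = 0`, for which
-- `μ₊ = iλ`; so the facts on linear systems apply to Bloch waves as well.
theorem IsHillSolution.isSystemSolution (hV : LocallyIntegrable V volume)
    (hψ : IsHillSolution V μ ψ) :
    IsSystemSolution (spectralMatrix V 0 0 0 0 (-Complex.I * μ))
      (fun x => ![ψ x, deriv ψ x, 0, 0]) := by
  have hψ' := hψ.contDiff.continuous_deriv_one
  have hcont : Continuous fun x => ![ψ x, deriv ψ x, 0, 0] :=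
    hψ.contDiff.continuous.matrixVecCons (hψ'.matrixVecCons continuous_const)
  refine ⟨hcont, fun x => funext fun i => ?_⟩
  have hint := intervalIntegrable_of_locallyIntegrable (locallyIntegrable_mulVec
    (locallyIntegrable_spectralMatrix hV continuous_zero 0 0 0 (-Complex.I * μ)) hcont) 0 x
  rw [Pi.add_apply, ← ContinuousLinearMap.proj_apply (R := ℂ) i (∫ t in (0 : ℝ)..x, _),
    ← ContinuousLinearMap.intervalIntegral_comp_comm _ hint]
  simp only [spectralMatrix_zero_mulVec, ContinuousLinearMap.proj_apply]
  fin_cases i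
  · have hFTC := intervalIntegral.integral_deriv_eq_sub
      (fun y _ => (hψ.contDiff.differentiable one_ne_zero).differentiableAt)
      (hψ'.intervalIntegrable 0 x)
    simp [hFTC]
  · exact hψ.eqn x
  all_goals simp

theorem tendsto_zero_of_quasiperiodic {E : Type*} [NormedAddCommGroup E] [NormedSpace ℂ E]
    {f : ℝ → E} (hd : d ≠ 0) (hf : Continuous f)
    (hper : ∀ x, f (x + d) = Complex.exp (Complex.I * k * d) • f x)
    (hl : Tendsto (fun x => k.im * x) l atTop) : Tendsto f l (𝓝 0) := by
  set q : ℝ → E := fun x => Complex.exp (-(Complex.I * k * x)) • f x with hq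
  have hqper : Function.Periodic q d := fun x => by
    simp only [hq, hper, smul_smul, ← Complex.exp_add]
    congr 2
    push_cast
    ring
  obtain ⟨C, hC⟩ := (hqper.isBounded_of_continuous hd (by fun_prop)).exists_norm_le
  have hfq (x : ℝ) : ‖f x‖ ≤ Real.exp (-(k.im * x)) * C :=
    calc ‖f x‖ = ‖Complex.exp (Complex.I * k * x) • q x‖ := by
          rw [hq, smul_smul, ← Complex.exp_add, add_neg_cancel, Complex.exp_zero, one_smul]
      _ = Real.exp (-(k.im * x)) * ‖q x‖ := by simp [norm_smul, Complex.norm_exp]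
      _ ≤ Real.exp (-(k.im * x)) * C := by
          gcongr
          exact hC _ (mem_range_self x)
  refine squeeze_zero_norm hfq ?_
  simpa using (Real.tendsto_exp_neg_atTop_nhds_zero.comp hl).mul_const C

namespace IsBlochWave

theorem apply_zero (h : IsBlochWave V d μ k ψ) : ψ 0 = 1 := by
  obtain ⟨p, -, hp₀, hp⟩ := h.bloch
  simp [hp, hp₀]

theorem apply_add (h : IsBlochWave V d μ k ψ) {y : ℝ} (hy : y ∈ AddSubgroup.zmultiples d)
    (x : ℝ) : ψ (x + y) = Complex.exp (Complex.I * k * y) * ψ x := by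
  obtain ⟨p, hper, -, hp⟩ := h.bloch
  obtain ⟨n, rfl⟩ := AddSubgroup.mem_zmultiples_iff.1 hy
  rw [hp, hp, hper.zsmul n x, Complex.ofReal_add, mul_add, Complex.exp_add]
  ring

theorem deriv_add (h : IsBlochWave V d μ k ψ) {y : ℝ} (hy : y ∈ AddSubgroup.zmultiples d)
    (x : ℝ) : deriv ψ (x + y) = Complex.exp (Complex.I * k * y) * deriv ψ x := by
  rw [← deriv_comp_add_const, funext (h.apply_add hy), deriv_const_mul_field]

theorem apply_eq_exp (h : IsBlochWave V d μ k ψ) {x : ℝ} (hx : x ∈ AddSubgroup.zmultiples d) :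
    ψ x = Complex.exp (Complex.I * k * x) := by
  simpa [h.apply_zero] using h.apply_add hx 0

theorem apply_ne_zero (h : IsBlochWave V d μ k ψ) {x : ℝ} (hx : x ∈ AddSubgroup.zmultiples d) :
    ψ x ≠ 0 :=
  h.apply_eq_exp hx ▸ Complex.exp_ne_zero _

-- Between lattice points `ψ` may vanish, and the estimate may fail there.
theorem isBigO_deriv (h : IsBlochWave V d μ k ψ) :
    deriv ψ =O[𝓟 (AddSubgroup.zmultiples d : Set ℝ)] ψ := by
  refine IsBigO.of_bound ‖deriv ψ 0‖ (eventually_principal.2 fun x hx => ?_)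
  have hderiv := h.deriv_add hx 0
  rw [zero_add, ← h.apply_eq_exp hx] at hderiv
  rw [hderiv, norm_mul, mul_comm]

theorem tendsto_zero (hd : d ≠ 0) (h : IsBlochWave V d μ k ψ)
    (hl : Tendsto (fun x => k.im * x) l atTop) : Tendsto ψ l (𝓝 0) :=
  tendsto_zero_of_quasiperiodic hd h.hill.contDiff.continuous
    (h.apply_add (AddSubgroup.mem_zmultiples d)) hl

theorem tendsto_deriv_zero (hd : d ≠ 0) (h : IsBlochWave V d μ k ψ)
    (hl : Tendsto (fun x => k.im * x) l atTop) : Tendsto (deriv ψ) l (𝓝 0) :=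
  tendsto_zero_of_quasiperiodic hd h.hill.contDiff.continuous_deriv_one
    (h.deriv_add (AddSubgroup.mem_zmultiples d)) hl

end IsBlochWave

/-- A Bloch wave `p(x) e^{ikx}` with unspecified `k` that decays along `l`. As
`|e^{ikx}| = e^{-x Im k}`, the decay is expressed by `x Im k → ∞`. -/
def IsDecayingBlochWave (V : ℝ → ℝ) (d : ℝ) (μ : ℂ) (l : Filter ℝ) (ψ : ℝ → ℂ) : Prop :=
  ∃ k, IsBlochWave V d μ k ψ ∧ Tendsto (fun x => k.im * x) l atTop

namespace IsDecayingBlochWave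

theorem tendsto_vec_fst (hd : d ≠ 0) (h : IsDecayingBlochWave V d μ l ψ) :
    Tendsto (fun x => ![ψ x, deriv ψ x, 0, 0]) l (𝓝 0) := by
  obtain ⟨k, hψ, hk⟩ := h
  refine tendsto_pi_nhds.2 fun i => ?_
  fin_cases i
  exacts [hψ.tendsto_zero hd hk, hψ.tendsto_deriv_zero hd hk, tendsto_const_nhds,
    tendsto_const_nhds]

theorem tendsto_vec_snd (hd : d ≠ 0) (h : IsDecayingBlochWave V d μ l ψ) :
    Tendsto (fun x => ![0, 0, ψ x, deriv ψ x]) l (𝓝 0) := by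
  obtain ⟨k, hψ, hk⟩ := h
  refine tendsto_pi_nhds.2 fun i => ?_
  fin_cases i
  exacts [tendsto_const_nhds, tendsto_const_nhds, hψ.tendsto_zero hd hk,
    hψ.tendsto_deriv_zero hd hk]

theorem isBigO_vec_fst (h : IsDecayingBlochWave V d μ l ψ) :
    (fun x => ![ψ x, deriv ψ x, 0, 0]) =O[𝓟 (AddSubgroup.zmultiples d : Set ℝ)] ψ := by
  obtain ⟨k, hψ, -⟩ := h
  refine isBigO_pi.2 fun i => ?_
  fin_cases i
  exacts [isBigO_refl _ _, hψ.isBigO_deriv, isBigO_zero _ _, isBigO_zero _ _]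

theorem isBigO_vec_snd (h : IsDecayingBlochWave V d μ l ψ) :
    (fun x => ![0, 0, ψ x, deriv ψ x]) =O[𝓟 (AddSubgroup.zmultiples d : Set ℝ)] ψ := by
  obtain ⟨k, hψ, -⟩ := h
  refine isBigO_pi.2 fun i => ?_
  fin_cases i
  exacts [isBigO_zero _ _, isBigO_zero _ _, isBigO_refl _ _, hψ.isBigO_deriv]

theorem apply_ne_zero (h : IsDecayingBlochWave V d μ l ψ) {x : ℝ}
    (hx : x ∈ AddSubgroup.zmultiples d) : ψ x ≠ 0 :=
  have ⟨_, hψ, _⟩ := h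
  hψ.apply_ne_zero hx

theorem unique [l.NeBot] (hd : d ≠ 0) (hV : LocallyIntegrable V volume)
    (h : IsDecayingBlochWave V d μ l ψ) (h' : IsDecayingBlochWave V d μ l ψ') : ψ = ψ' := by
  obtain ⟨k, hψ, -⟩ := id h
  obtain ⟨k', hψ', -⟩ := id h'
  have hA := isHamiltonianSystem_spectralMatrix hV continuous_zero 0 0 0 (-Complex.I * μ)
  have hsol := hψ.hill.isSystemSolution hV
  have hsol' := hψ'.hill.isSystemSolution hV
  have hderiv : deriv ψ' 0 = deriv ψ 0 := by
    have hwronskian := hsol.wronskian_eq_zero hA hsol' (h.tendsto_vec_fst hd)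
      (h'.tendsto_vec_fst hd) 0
    simpa [wronskian, hψ.apply_zero, hψ'.apply_zero, sub_eq_zero] using hwronskian
  have heq := hsol.eq_of_apply_eq hA.locallyIntegrable hsol' (x₀ := 0)
    (by rw [hψ.apply_zero, hψ'.apply_zero, hderiv])
  exact funext fun x => congrFun (congrFun heq x) 0

end IsDecayingBlochWave

end BlochWaves

section JostPairs

variable {V : ℝ → ℝ} {d Γp Γm μs : ℝ} {φ : ℝ → ℝ} {lam : ℂ} {l : Filter ℝ}
  {ψp ψm ψp' ψm' : ℝ → ℂ} {v w v' w' : ℝ → Fin 4 → ℂ}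

/-- A pair of solutions of the spectral system that decay along `l`, each asymptotic to a decaying
Bloch wave in one of the two components: one half of an `EvansFrame`. -/
structure IsJostPair (V : ℝ → ℝ) (d Γp Γm μs : ℝ) (φ : ℝ → ℝ) (lam : ℂ) (l : Filter ℝ)
    (ψp ψm : ℝ → ℂ) (v w : ℝ → Fin 4 → ℂ) : Prop where
  bloch_fst : IsDecayingBlochWave V d (μs + Complex.I * lam) l ψp
  bloch_snd : IsDecayingBlochWave V d (μs - Complex.I * lam) l ψm
  sol_fst : IsSystemSolution (spectralMatrix V Γp Γm μs φ lam) v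
  sol_snd : IsSystemSolution (spectralMatrix V Γp Γm μs φ lam) w
  asymp_fst : v ~[l] fun x => ![ψp x, deriv ψp x, 0, 0]
  asymp_snd : w ~[l] fun x => ![0, 0, ψm x, deriv ψm x]

theorem neBot_atTop_inf_zmultiples (hd : d ≠ 0) :
    (atTop ⊓ 𝓟 (AddSubgroup.zmultiples d : Set ℝ)).NeBot := by
  refine frequently_mem_iff_neBot.1 (frequently_atTop.2 fun a => ?_)
  obtain ⟨n, hn⟩ := Archimedean.arch a (abs_pos.2 hd)
  exact ⟨n • |d|, hn, nsmul_mem (abs_mem_iff.2 (AddSubgroup.mem_zmultiples d)) n⟩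

theorem neBot_atBot_inf_zmultiples (hd : d ≠ 0) :
    (atBot ⊓ 𝓟 (AddSubgroup.zmultiples d : Set ℝ)).NeBot := by
  refine frequently_mem_iff_neBot.1 (frequently_atBot.2 fun a => ?_)
  obtain ⟨n, hn⟩ := Archimedean.arch (-a) (abs_pos.2 hd)
  exact ⟨-(n • |d|), neg_le.1 hn,
    neg_mem (nsmul_mem (abs_mem_iff.2 (AddSubgroup.mem_zmultiples d)) n)⟩

namespace IsJostPair

theorem tendsto_fst (hd : d ≠ 0) (h : IsJostPair V d Γp Γm μs φ lam l ψp ψm v w) :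
    Tendsto v l (𝓝 0) :=
  h.asymp_fst.symm.tendsto_nhds (h.bloch_fst.tendsto_vec_fst hd)

theorem tendsto_snd (hd : d ≠ 0) (h : IsJostPair V d Γp Γm μs φ lam l ψp ψm v w) :
    Tendsto w l (𝓝 0) :=
  h.asymp_snd.symm.tendsto_nhds (h.bloch_snd.tendsto_vec_snd hd)

theorem positionMinor_isEquivalent (h : IsJostPair V d Γp Γm μs φ lam l ψp ψm v w) :
    (fun x => positionMinor (v x) (w x))
      ~[l ⊓ 𝓟 (AddSubgroup.zmultiples d : Set ℝ)] fun x => ψp x * ψm x := by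
  have hv := isLittleO_pi.1 <| (h.asymp_fst.isLittleO.mono inf_le_left).trans_isBigO
    (h.bloch_fst.isBigO_vec_fst.mono inf_le_right)
  have hw := isLittleO_pi.1 <| (h.asymp_snd.isLittleO.mono inf_le_left).trans_isBigO
    (h.bloch_snd.isBigO_vec_snd.mono inf_le_right)
  have hv₀ : (fun x => v x 0) ~[l ⊓ 𝓟 (AddSubgroup.zmultiples d : Set ℝ)] ψp := hv 0
  have hw₂ : (fun x => w x 2) ~[l ⊓ 𝓟 (AddSubgroup.zmultiples d : Set ℝ)] ψm := hw 2
  have hv₂ : (fun x => v x 2) =o[l ⊓ 𝓟 (AddSubgroup.zmultiples d : Set ℝ)] ψp := by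
    simpa using hv 2
  have hw₀ : (fun x => w x 0) =o[l ⊓ 𝓟 (AddSubgroup.zmultiples d : Set ℝ)] ψm := by
    simpa using hw 0
  exact (hv₀.mul hw₂).sub_isLittleO (hv₂.mul hw₀)

theorem eventually_positionMinor_ne_zero (h : IsJostPair V d Γp Γm μs φ lam l ψp ψm v w) :
    ∀ᶠ x in l ⊓ 𝓟 (AddSubgroup.zmultiples d : Set ℝ), positionMinor (v x) (w x) ≠ 0 := by
  filter_upwards [h.positionMinor_isEquivalent.symm.isBigO.eq_zero_imp,
    mem_inf_of_right (mem_principal_self _)] with x hzero hx hminor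
  exact mul_ne_zero (h.bloch_fst.apply_ne_zero hx) (h.bloch_snd.apply_ne_zero hx) (hzero hminor)

-- The minors of both pairs are asymptotic to the product of the two Bloch waves, which are unique;
-- their constant ratio, the determinant of the transition matrix, is therefore one.
theorem exists_unimodular_combination (hd : d ≠ 0) (hV : LocallyIntegrable V volume)
    (hφ : Continuous φ) [hl : (l ⊓ 𝓟 (AddSubgroup.zmultiples d : Set ℝ)).NeBot]
    (h : IsJostPair V d Γp Γm μs φ lam l ψp ψm v w)
    (h' : IsJostPair V d Γp Γm μs φ lam l ψp' ψm' v' w') :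
    ∃ a b c e : ℂ, a * e - b * c = 1 ∧ v' = a • v + b • w ∧ w' = c • v + e • w := by
  have : l.NeBot := hl.mono inf_le_left
  obtain rfl := h.bloch_fst.unique hd hV h'.bloch_fst
  obtain rfl := h.bloch_snd.unique hd hV h'.bloch_snd
  have hne := h.eventually_positionMinor_ne_zero
  obtain ⟨x, hx⟩ := hne.exists
  have hcombination {z : ℝ → Fin 4 → ℂ}
      (hz : IsSystemSolution (spectralMatrix V Γp Γm μs φ lam) z) (hzl : Tendsto z l (𝓝 0)) :=
    hz.exists_eq_combination (isHamiltonianSystem_spectralMatrix hV hφ Γp Γm μs lam)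
      h.sol_fst h.sol_snd hzl (h.tendsto_fst hd) (h.tendsto_snd hd)
      (linearIndependent_pair_of_positionMinor_ne_zero hx)
  obtain ⟨a, b, rfl⟩ := hcombination h'.sol_fst (h'.tendsto_fst hd)
  obtain ⟨c, e, rfl⟩ := hcombination h'.sol_snd (h'.tendsto_snd hd)
  refine ⟨a, b, c, e, ?_, rfl, rfl⟩
  by_contra hdet
  have hsmall : (fun x => (a * e - b * c - 1) * positionMinor (v x) (w x))
      =o[l ⊓ 𝓟 (AddSubgroup.zmultiples d : Set ℝ)] fun x => positionMinor (v x) (w x) := by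
    simpa only [Pi.sub_def, Pi.add_apply, Pi.smul_apply, positionMinor_combination, sub_one_mul]
      using (h'.positionMinor_isEquivalent.trans h.positionMinor_isEquivalent.symm).isLittleO
  exact isLittleO_irrefl hne.frequently <|
    (isLittleO_const_mul_left_iff (sub_ne_zero.2 hdet)).1 hsmall

end IsJostPair

end JostPairs

section Frames

variable {V : ℝ → ℝ} {d Γp Γm μs : ℝ} {φ : ℝ → ℝ} {lam : ℂ}

namespace EvansFrame

theorem isJostPair_atBot (F : EvansFrame V d Γp Γm μs φ lam) :
    IsJostPair V d Γp Γm μs φ lam atBot F.ψp₂ F.ψm₂ F.vm₁ F.vm₂ where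
  bloch_fst := ⟨_, F.bloch_p₂,
    tendsto_id.const_mul_atBot_of_neg (by simpa using F.kp_im_pos)⟩
  bloch_snd := ⟨_, F.bloch_m₂,
    tendsto_id.const_mul_atBot_of_neg (by simpa using F.km_im_pos)⟩
  sol_fst := F.sol_vm₁
  sol_snd := F.sol_vm₂
  asymp_fst := F.asymp_vm₁
  asymp_snd := F.asymp_vm₂

theorem isJostPair_atTop (F : EvansFrame V d Γp Γm μs φ lam) :
    IsJostPair V d Γp Γm μs φ lam atTop F.ψp₁ F.ψm₁ F.vp₁ F.vp₂ where
  bloch_fst := ⟨_, F.bloch_p₁, tendsto_id.const_mul_atTop F.kp_im_pos⟩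
  bloch_snd := ⟨_, F.bloch_m₁, tendsto_id.const_mul_atTop F.km_im_pos⟩
  sol_fst := F.sol_vp₁
  sol_snd := F.sol_vp₂
  asymp_fst := F.asymp_vp₁
  asymp_snd := F.asymp_vp₂

theorem det_apply_eq (hV : LocallyIntegrable V volume) (hφ : Continuous φ)
    (F : EvansFrame V d Γp Γm μs φ lam) (x y : ℝ) : F.det x = F.det y := by
  have hwronskian {v w} (hv : IsSystemSolution (spectralMatrix V Γp Γm μs φ lam) v)
      (hw : IsSystemSolution (spectralMatrix V Γp Γm μs φ lam) w) :=
    hv.wronskian_eq (isHamiltonianSystem_spectralMatrix hV hφ Γp Γm μs lam) hw x y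
  rw [det, det, det_eq_wronskian, det_eq_wronskian,
    hwronskian F.sol_vm₁ F.sol_vm₂, hwronskian F.sol_vm₁ F.sol_vp₁, hwronskian F.sol_vm₁ F.sol_vp₂,
    hwronskian F.sol_vm₂ F.sol_vp₁, hwronskian F.sol_vm₂ F.sol_vp₂, hwronskian F.sol_vp₁ F.sol_vp₂]

theorem det_eq_det (hd : d ≠ 0) (hV : LocallyIntegrable V volume) (hφ : Continuous φ)
    (F G : EvansFrame V d Γp Γm μs φ lam) (x : ℝ) : F.det x = G.det x := by
  have := neBot_atBot_inf_zmultiples hd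
  have := neBot_atTop_inf_zmultiples hd
  obtain ⟨a, b, c, e, hm, hm₁, hm₂⟩ :=
    G.isJostPair_atBot.exists_unimodular_combination hd hV hφ F.isJostPair_atBot
  obtain ⟨a', b', c', e', hp, hp₁, hp₂⟩ :=
    G.isJostPair_atTop.exists_unimodular_combination hd hV hφ F.isJostPair_atTop
  simp only [det, hm₁, hm₂, hp₁, hp₂, Pi.add_apply, Pi.smul_apply]
  rw [det_combination_pairs, hm, hp, one_mul, one_mul]

theorem det_eq_evansFunction (hd : d ≠ 0) (hV : LocallyIntegrable V volume) (hφ : Continuous φ)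
    (F : EvansFrame V d Γp Γm μs φ lam) (x xs : ℝ) :
    F.det x = evansFunction V d Γp Γm μs φ xs lam := by
  rw [evansFunction, dif_pos ⟨F⟩, F.det_apply_eq hV hφ x xs]
  exact F.det_eq_det hd hV hφ _ xs

end EvansFrame

end Frames

section Conjugation

open scoped ComplexConjugate

/-- Complex conjugation of a vector `(u₁, u₁', u₂, u₂')` together with the exchange of `u₁` and
`u₂`. It carries the spectral system at `λ` to the one at the conjugate of `λ`. -/
noncomputable def conjSwap : (Fin 4 → ℂ) →L[ℝ] (Fin 4 → ℂ) :=
  ContinuousLinearMap.pi fun i =>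
    (Complex.conjCLE : ℂ →L[ℝ] ℂ).comp (ContinuousLinearMap.proj (i + 2))

theorem conjSwap_apply (v : Fin 4 → ℂ) (i : Fin 4) : conjSwap v i = conj (v (i + 2)) := rfl

theorem conjSwap_vec (a b c e : ℂ) :
    conjSwap ![a, b, c, e] = ![conj c, conj e, conj a, conj b] := by
  ext i
  fin_cases i <;> rfl

theorem conjSwap_conjSwap (v : Fin 4 → ℂ) : conjSwap (conjSwap v) = v := by
  ext i
  fin_cases i <;> exact Complex.conj_conj _

theorem norm_conjSwap (v : Fin 4 → ℂ) : ‖conjSwap v‖ = ‖v‖ := by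
  have hle (u : Fin 4 → ℂ) : ‖conjSwap u‖ ≤ ‖u‖ :=
    (pi_norm_le_iff_of_nonneg (norm_nonneg u)).2 fun i => by
      rw [conjSwap_apply, RCLike.norm_conj]
      exact norm_le_pi_norm u (i + 2)
  refine (hle v).antisymm ?_
  simpa only [conjSwap_conjSwap] using hle (conjSwap v)

theorem wronskian_conjSwap (v w : Fin 4 → ℂ) :
    wronskian (conjSwap v) (conjSwap w) = conj (wronskian v w) := by
  simp only [wronskian, conjSwap_apply, Fin.reduceAdd, map_add, map_sub, map_mul]
  ring

variable {V : ℝ → ℝ} {d Γp Γm μs : ℝ} {φ : ℝ → ℝ} {lam : ℂ}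

theorem conjSwap_mulVec_spectralMatrix (x : ℝ) (v : Fin 4 → ℂ) :
    conjSwap (spectralMatrix V Γp Γm μs φ lam x *ᵥ v) =
      spectralMatrix V Γp Γm μs φ (conj lam) x *ᵥ conjSwap v := by
  simp only [spectralMatrix_mulVec, conjSwap_vec, conjSwap_apply, map_add, map_sub, map_mul,
    Complex.conj_ofReal, Complex.conj_I, Complex.conj_ofNat, Fin.reduceAdd, neg_mul, sub_neg_eq_add,
    ← sub_eq_add_neg]

theorem IsSystemSolution.conjSwap_comp (hV : LocallyIntegrable V volume) (hφ : Continuous φ)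
    {v : ℝ → Fin 4 → ℂ} (hv : IsSystemSolution (spectralMatrix V Γp Γm μs φ lam) v) :
    IsSystemSolution (spectralMatrix V Γp Γm μs φ (conj lam)) fun x => conjSwap (v x) := by
  refine ⟨conjSwap.continuous.comp hv.continuous, fun x => ?_⟩
  have hint := intervalIntegrable_of_locallyIntegrable (locallyIntegrable_mulVec
    (locallyIntegrable_spectralMatrix hV hφ Γp Γm μs lam) hv.continuous) 0 x
  simp only [← conjSwap_mulVec_spectralMatrix]
  rw [ContinuousLinearMap.intervalIntegral_comp_comm _ hint, ← map_add, ← hv.eqn x]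

theorem isEquivalent_conjSwap {l : Filter ℝ} {v w : ℝ → Fin 4 → ℂ} (h : v ~[l] w) :
    (fun x => conjSwap (v x)) ~[l] fun x => conjSwap (w x) := by
  refine IsLittleO.of_norm_norm (h.isLittleO.norm_norm.congr (fun x => ?_) fun x => ?_)
  · rw [Pi.sub_apply, Pi.sub_apply, ← map_sub, norm_conjSwap]
  · rw [norm_conjSwap]

theorem deriv_conj (ψ : ℝ → ℂ) (x : ℝ) : deriv (fun y => conj (ψ y)) x = conj (deriv ψ x) :=
  deriv.star

theorem IsBlochWave.conjugate {μ k : ℂ} {ψ : ℝ → ℂ} (h : IsBlochWave V d μ k ψ) :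
    IsBlochWave V d (conj μ) (-conj k) fun x => conj (ψ x) where
  hill :=
    { contDiff := Complex.conjCLE.contDiff.comp h.hill.contDiff
      eqn := fun x => by
        simp only [deriv_conj]
        rw [h.hill.eqn x, map_add, intervalIntegral, intervalIntegral, map_sub, ← integral_conj,
          ← integral_conj]
        simp }
  bloch := by
    obtain ⟨p, hper, hp₀, hp⟩ := h.bloch
    refine ⟨fun x => conj (p x), fun x => by simp [hper x], by simp [hp₀], fun x => ?_⟩
    simp [hp, ← Complex.exp_conj]

namespace EvansFrame

/-- The frame at the conjugate of `λ` obtained from one at `λ` by `conjSwap`. As conjugation maps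
`μ_±` at `λ` to `μ_∓` at the conjugate of `λ`, the two Bloch waves trade places. -/
noncomputable def conjugate (hV : LocallyIntegrable V volume) (hφ : Continuous φ)
    (F : EvansFrame V d Γp Γm μs φ lam) : EvansFrame V d Γp Γm μs φ (conj lam) where
  kp := -conj F.km
  km := -conj F.kp
  ψp₁ x := conj (F.ψm₁ x)
  ψp₂ x := conj (F.ψm₂ x)
  ψm₁ x := conj (F.ψp₁ x)
  ψm₂ x := conj (F.ψp₂ x)
  vm₁ x := conjSwap (F.vm₂ x)
  vm₂ x := conjSwap (F.vm₁ x)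
  vp₁ x := conjSwap (F.vp₂ x)
  vp₂ x := conjSwap (F.vp₁ x)
  kp_im_pos := by simpa using F.km_im_pos
  km_im_pos := by simpa using F.kp_im_pos
  bloch_p₁ := by simpa using F.bloch_m₁.conjugate
  bloch_p₂ := by simpa using F.bloch_m₂.conjugate
  bloch_m₁ := by simpa [← sub_eq_add_neg] using F.bloch_p₁.conjugate
  bloch_m₂ := by simpa [← sub_eq_add_neg] using F.bloch_p₂.conjugate
  sol_vm₁ := F.sol_vm₂.conjSwap_comp hV hφ
  sol_vm₂ := F.sol_vm₁.conjSwap_comp hV hφ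
  sol_vp₁ := F.sol_vp₂.conjSwap_comp hV hφ
  sol_vp₂ := F.sol_vp₁.conjSwap_comp hV hφ
  asymp_vm₁ := by simpa [conjSwap_vec, deriv_conj] using isEquivalent_conjSwap F.asymp_vm₂
  asymp_vm₂ := by simpa [conjSwap_vec, deriv_conj] using isEquivalent_conjSwap F.asymp_vm₁
  asymp_vp₁ := by simpa [conjSwap_vec, deriv_conj] using isEquivalent_conjSwap F.asymp_vp₂
  asymp_vp₂ := by simpa [conjSwap_vec, deriv_conj] using isEquivalent_conjSwap F.asymp_vp₁

theorem det_conjugate (hV : LocallyIntegrable V volume) (hφ : Continuous φ)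
    (F : EvansFrame V d Γp Γm μs φ lam) (x : ℝ) :
    (F.conjugate hV hφ).det x = conj (F.det x) := by
  simp only [det, det_eq_wronskian, conjugate, wronskian_conjSwap, map_add, map_sub, map_mul]
  simp only [wronskian, map_add, map_sub, map_mul]
  ring

end EvansFrame

theorem nonempty_evansFrame_conj_iff (hV : LocallyIntegrable V volume) (hφ : Continuous φ) :
    Nonempty (EvansFrame V d Γp Γm μs φ (conj lam)) ↔
      Nonempty (EvansFrame V d Γp Γm μs φ lam) :=
  ⟨fun ⟨F⟩ => Complex.conj_conj lam ▸ ⟨F.conjugate hV hφ⟩, fun ⟨F⟩ => ⟨F.conjugate hV hφ⟩⟩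

theorem evansFunction_conj (hd : d ≠ 0) (hV : LocallyIntegrable V volume) (hφ : Continuous φ)
    (xs : ℝ) : evansFunction V d Γp Γm μs φ xs (conj lam) =
      conj (evansFunction V d Γp Γm μs φ xs lam) := by
  by_cases hF : Nonempty (EvansFrame V d Γp Γm μs φ lam)
  · obtain ⟨F⟩ := hF
    rw [← F.det_eq_evansFunction hd hV hφ xs, ← F.det_conjugate hV hφ,
      (F.conjugate hV hφ).det_eq_evansFunction hd hV hφ xs]
  · rw [evansFunction, evansFunction, dif_neg hF,
      dif_neg ((nonempty_evansFrame_conj_iff hV hφ).not.2 hF), map_zero]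

end Conjugation

theorem lemma3_general (d : ℝ) (hd : d ≠ 0) (V : ℝ → ℝ) (hV : LocallyIntegrable V volume)
    (Γp Γm μs : ℝ) (φ : ℝ → ℝ) (hφ : Continuous φ) (xs : ℝ) (lam : ℂ) :
    (∀ (F : EvansFrame V d Γp Γm μs φ lam) (x : ℝ),
      F.det x = evansFunction V d Γp Γm μs φ xs lam) ∧
    (Nonempty (EvansFrame V d Γp Γm μs φ (starRingEnd ℂ lam)) ↔
      Nonempty (EvansFrame V d Γp Γm μs φ lam)) ∧
    evansFunction V d Γp Γm μs φ xs (starRingEnd ℂ lam) =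
      starRingEnd ℂ (evansFunction V d Γp Γm μs φ xs lam) :=
  ⟨fun F x => F.det_eq_evansFunction hd hV hφ x xs, nonempty_evansFrame_conj_iff hV hφ,
    evansFunction_conj hd hV hφ xs⟩

theorem lemma3 (d : ℝ) (hd : 0 < d) (V : ℝ → ℝ) (hV : LocallyIntegrable V volume)
    (hper : Function.Periodic V d) (Γp Γm μs : ℝ) (φ : ℝ → ℝ)
    (hφ : IsGapSoliton V Γp Γm μs φ) (xs : ℝ) (lam : ℂ) :
    -- the value does not depend on the choices made, nor on the matching point
    (∀ (F : EvansFrame V d Γp Γm μs φ lam) (x : ℝ),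
      F.det x = evansFunction V d Γp Γm μs φ xs lam) ∧
    -- the domain of definition is symmetric
    (Nonempty (EvansFrame V d Γp Γm μs φ (starRingEnd ℂ lam)) ↔
      Nonempty (EvansFrame V d Γp Γm μs φ lam)) ∧
    -- the symmetry
    evansFunction V d Γp Γm μs φ xs (starRingEnd ℂ lam) =
      starRingEnd ℂ (evansFunction V d Γp Γm μs φ xs lam) :=
  lemma3_general d hd.ne' V hV Γp Γm μs φ hφ.contDiff.continuous xs lam
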